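/- All sequences are indexed by $\mathbb{N}_0$ and have real or complex terms. Let $p=(p_k)$ and $q=(q_k)$ be bounded sequences of strictly positive real numbers, and let $r,s,t$ be scalar sequences with $r_n\neq 0$ and $t_n\neq 0$ for all $n$ and $s_0\neq 0$. Put $$l_\infty(q)=\{x:\sup_k|x_k|^{q_k}<\infty\},\qquad c_0(q)=\{x:\lim_k|x_k|^{q_k}=0\},\qquad c(q)=\{x:\lim_k|x_k-l|^{q_k}=0\text{ for some scalar }l\},$$ and, with $\Delta x_k=x_k-x_{k-1}$, $x_{-1}=0$, $$l_\infty(r,s,t,p;\Delta)=\Big\{x:\ \Big(\frac1{r_n}\sum_{k=0}^n s_{n-k}t_k\,\Delta x_k\Big)_n\in l_\infty(p)\Big\}.$$ For sets $U,V$ of sequences, $U^\beta$ is the set of sequences $a$ such that $\sum_k a_kx_k$ converges for every $x\in U$, and $(U,V)$ is the set of infinite matrices $A=(a_{nk})$ such that for every $x\in U$ all the series $(Ax)_n=\sum_k a_{nk}x_k$ converge and $Ax\in V$. Let $D_0^{(s)}=1/s_0$ and, for $n\ge1$, let $D_n^{(s)}=s_0^{-(n+1)}\det(s_{i-j+1})_{1\le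 i,j\le n}$, where $s_i=0$ for $i<0$. For an infinite matrix $A=(a_{nk})$ put, for $k\le m$, $$e^{(n)}_{mk}=r_k\bigg[\frac{a_{nk}}{s_0t_k}+\Big(\frac{D_0^{(s)}}{t_k}-\frac{D_1^{(s)}}{t_{k+1}}\Big)\sum_{j=k+1}^{m}a_{nj}+\sum_{l=k+2}^{m}(-1)^{l-k}\frac{D_{l-k}^{(s)}}{t_l}\sum_{j=l}^{m}a_{nj}\bigg]$$ (empty sums being $0$), and $\tilde e_{nk}=\lim_{m\to\infty}e^{(n)}_{mk}$. Consider the condition (R) $(a_{nk})_k\in[l_\infty(r,s,t,p;\Delta)]^\beta$ for every $n$. If (R) holds, then the limits $\tilde e_{nk}$ exist for all $n,k$. Moreover: (a) $A\in(l_\infty(r,s,t,p;\Delta),c_0(q))$ if and only if (R) holds and $$\forall N\in\mathbb{N}:\ \lim_n\Big(\sum_k|\tilde e_{nk}|N^{1/p_k}\Big)^{q_n}=0;$$ (b) $A\in(l_\infty(r,s,t,p;\Delta),c(q))$ if and only if (R) holds, $$\forall N\in\mathbb{N}:\ \sup_n\sum_k|\tilde e_{nk}|N^{1/p_k}<\infty,$$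 and there is a scalar sequence $(\alpha_k)$ such that $$\forall N\in\mathbb{N}:\ \lim_n\Big(\sum_k|\tilde e_{nk}-\alpha_k|N^{1/p_k}\Big)^{q_n}=0;$$ (c) $A\in(l_\infty(r,s,t,p;\Delta),l_\infty(q))$ if and only if (R) holds and $$\forall N\in\mathbb{N}:\ \sup_n\Big(\sum_k|\tilde e_{nk}|N^{1/p_k}\Big)^{q_n}<\infty.$$ -/

import Mathlib

open Filter Topology

noncomputable section

namespace SeqSpace

variable {𝕜 : Type*} [RCLike 𝕜]

/-- The Maddox space `l_∞(p)`. -/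
def lInfty (p : ℕ → ℝ) : Set (ℕ → 𝕜) :=
  {x | BddAbove (Set.range fun k => ‖x k‖ ^ p k)}

/-- The Maddox space `c(p)`. -/
def cSpace (p : ℕ → ℝ) : Set (ℕ → 𝕜) :=
  {x | ∃ l : 𝕜, Tendsto (fun k => ‖x k - l‖ ^ p k) atTop (𝓝 0)}

/-- The Maddox space `c_0(p)`. -/
def cZero (p : ℕ → ℝ) : Set (ℕ → 𝕜) :=
  {x | Tendsto (fun k => ‖x k‖ ^ p k) atTop (𝓝 0)}

/-- `∑_{k=0}^∞ u_k` converges (possibly conditionally) to `l`. -/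
def SeriesTendsto (u : ℕ → 𝕜) (l : 𝕜) : Prop :=
  Tendsto (fun n => ∑ k ∈ Finset.range n, u k) atTop (𝓝 l)

/-- The space `cs` of convergent series. -/
def cs : Set (ℕ → 𝕜) := {u | ∃ l, SeriesTendsto u l}

/-- The β-dual of a set of sequences. -/
def betaDual (U : Set (ℕ → 𝕜)) : Set (ℕ → 𝕜) :=
  {a | ∀ x ∈ U, (fun k => a k * x k) ∈ cs}

/-- The class `(U, V)` of infinite matrices mapping `U` into `V`: for all `x ∈ U` the series
`(Ax)_n = ∑_k a_{nk} x_k` converge, and `Ax ∈ V`. -/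
def matrixClass (U V : Set (ℕ → 𝕜)) : Set (ℕ → ℕ → 𝕜) :=
  {A | ∀ x ∈ U, ∃ y ∈ V, ∀ n, SeriesTendsto (fun k => A n k * x k) (y n)}

/-- The backward difference `Δx_k = x_k - x_{k-1}`, with `x_{-1} = 0`. -/
def diff (x : ℕ → 𝕜) (k : ℕ) : 𝕜 := if k = 0 then x 0 else x k - x (k - 1)

/-- The generalized mean `(1 / r_n) ∑_{k=0}^n s_{n-k} t_k x_k`. -/
def genMean (r s t x : ℕ → 𝕜) (n : ℕ) : 𝕜 :=
  1 / r n * ∑ k ∈ Finset.range (n + 1), s (n - k) * t k * x k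

/-- The space `l_∞(r, s, t, p; Δ)`. -/
def lInftyMeanDiff (r s t : ℕ → 𝕜) (p : ℕ → ℝ) : Set (ℕ → 𝕜) :=
  {x | genMean r s t (diff x) ∈ lInfty p}

/-- `D_n^{(s)}`: the determinant of the `n × n` matrix whose `i`-th row (from `0`) is
`s_{i+1}, s_i, …, s_0, 0, …, 0` (cut off after `n` entries), divided by `s_0^{n+1}`.
For `n = 0` the determinant is `1`, so `D_0 = 1 / s_0`. -/
def D (s : ℕ → 𝕜) (n : ℕ) : 𝕜 :=
  1 / s 0 ^ (n + 1) *
    Matrix.det (Matrix.of fun i j : Fin n =>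
      if (j : ℕ) ≤ (i : ℕ) + 1 then s ((i : ℕ) + 1 - (j : ℕ)) else 0)

/-- The triangle `E = (e_{mk})` associated with a sequence `a`. -/
def E (r s t a : ℕ → 𝕜) (m k : ℕ) : 𝕜 :=
  if k ≤ m then
    r k * (a k / (s 0 * t k)
      + (D s 0 / t k - D s 1 / t (k + 1)) * ∑ j ∈ Finset.Icc (k + 1) m, a j
      + ∑ l ∈ Finset.Icc (k + 2) m,
          (-1) ^ (l - k) * (D s (l - k) / t l) * ∑ j ∈ Finset.Icc l m, a j)
  else 0

/-- The matrix `Ẽ = (ẽ_{nk})` of an infinite matrix `A`: `ẽ_{nk}` is the limit as `m → ∞` of the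
entries `e_{mk}` formed from the `n`-th row of `A`. -/
def ETilde (r s t : ℕ → 𝕜) (A : ℕ → ℕ → 𝕜) (n k : ℕ) : 𝕜 :=
  limUnder atTop fun m => E r s t (A n) m k

/-- The extended nonnegative number `∑_k |u_k| N^{1/p_k}`. -/
def weightedSum (p : ℕ → ℝ) (N : ℕ) (u : ℕ → 𝕜) : ENNReal :=
  ∑' k, ENNReal.ofReal (‖u k‖ * (N : ℝ) ^ (1 / p k))

/-- `∀ N, lim_n (∑_k |a_{nk}| N^{1/p_k})^{q_n} = 0`. -/
def CondNull (p q : ℕ → ℝ) (a : ℕ → ℕ → 𝕜) : Prop :=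
  ∀ N : ℕ, 1 ≤ N → Tendsto (fun n => weightedSum p N (a n) ^ q n) atTop (𝓝 0)

/-- `∀ N, sup_n ∑_k |a_{nk}| N^{1/p_k} < ∞`. -/
def CondSup (p : ℕ → ℝ) (a : ℕ → ℕ → 𝕜) : Prop :=
  ∀ N : ℕ, 1 ≤ N → (⨆ n, weightedSum p N (a n)) < ⊤

/-- `∃ (α_k), ∀ N, lim_n (∑_k |a_{nk} - α_k| N^{1/p_k})^{q_n} = 0`. -/
def CondConv (p q : ℕ → ℝ) (a : ℕ → ℕ → 𝕜) : Prop :=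
  ∃ α : ℕ → 𝕜, ∀ N : ℕ, 1 ≤ N →
    Tendsto (fun n => weightedSum p N (fun k => a n k - α k) ^ q n) atTop (𝓝 0)

/-- `∀ N, sup_n (∑_k |a_{nk}| N^{1/p_k})^{q_n} < ∞`. -/
def CondSupPow (p q : ℕ → ℝ) (a : ℕ → ℕ → 𝕜) : Prop :=
  ∀ N : ℕ, 1 ≤ N → (⨆ n, weightedSum p N (a n) ^ q n) < ⊤

end SeqSpace

end

/-! In terms of power series, y = `genMean r s t (diff x)` is, up to the factors r_n, the Cauchy
product of (t_k Δx_k) with s. Since s_0 ≠ 0 this can be inverted, and Cramer's rule identifies the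
coefficients of the reciprocal of s (`coeff_inv_mk`). Hence every sequence y occurs, and
interchanging finite sums turns the partial sums of ∑ a_k x_k into ∑ e_{mk} y_k
(`sum_mul_eq_sum_E`).

The space l_∞(p) is the union over N of the sup-norm unit ball with coordinates scaled by N^{1/p_k}.
For each N, everything becomes a question about a sequence of ℓ¹ functionals tested on that ball.
The ball is compact in the product topology, so Baire's theorem applies. It upgrades pointwise
information to norm information up to finitely many coordinates (`exists_nearly_norming`), and unit
vectors control those. This gives Schur's theorem and its variants with exponents q_n.

Schur's theorem along m makes the rows of E converge in weighted ℓ¹, so Ax = Ẽy (`exists_limit_row`,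
`mem_matrixClass_iff`). The same principles along n give the necessity of the three conditions;
sufficiency rests on |∑ f_k z_k| ≤ ∑ |f_k|. -/

namespace SeqSpace

variable {𝕜 : Type*} [RCLike 𝕜]

/-! ### Reciprocal power series and the determinants D_n -/

/-- The lower triangular Toeplitz matrix of a sequence. -/
def toeplitz (s : ℕ → 𝕜) (n : ℕ) : Matrix (Fin n) (Fin n) 𝕜 :=
  Matrix.of fun i j => if (j : ℕ) ≤ i then s (i - j) else 0

theorem det_toeplitz (s : ℕ → 𝕜) (n : ℕ) : (toeplitz s n).det = s 0 ^ n := by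
  rw [Matrix.det_of_isLowerTriangular]
  · simp [toeplitz]
  · intro i j hij
    have : (i : ℕ) < j := hij
    rw [toeplitz, Matrix.of_apply, if_neg (by omega)]

/-- The coefficients of the reciprocal of the power series `∑ s_n X^n` are `(-1)^n D_n`. -/
theorem coeff_inv_mk (s : ℕ → 𝕜) (hs : s 0 ≠ 0) (n : ℕ) :
    PowerSeries.coeff n (PowerSeries.mk s)⁻¹ = (-1) ^ n * D s n := by
  set c : ℕ → 𝕜 := fun n => PowerSeries.coeff n (PowerSeries.mk s)⁻¹ with hc
  have hinv : (PowerSeries.mk s)⁻¹ * PowerSeries.mk s = 1 :=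
    PowerSeries.inv_mul_cancel _ (by simpa using hs)
  have hmul : (toeplitz s (n + 1)).mulVec (fun j => c j) = Pi.single 0 1 := by
    funext i
    have h := congrArg (PowerSeries.coeff (i : ℕ)) hinv
    rw [PowerSeries.coeff_mul, Finset.Nat.sum_antidiagonal_eq_sum_range_succ_mk] at h
    simp only [PowerSeries.coeff_mk, PowerSeries.coeff_one] at h
    have h2 : (toeplitz s (n + 1)).mulVec (fun j => c j) i
        = ∑ j ∈ Finset.range (n + 1), (if j ≤ (i : ℕ) then s (i - j) else 0) * c j := by
      rw [Finset.sum_range]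
      rfl
    have h3 : ∑ j ∈ Finset.range (n + 1), (if j ≤ (i : ℕ) then s (i - j) else 0) * c j
        = ∑ j ∈ Finset.range ((i : ℕ) + 1), c j * s (i - j) := by
      symm
      have hi := i.isLt
      apply Finset.sum_subset_zero_on_sdiff
      · intro j hj
        simp only [Finset.mem_range] at hj ⊢
        omega
      · intro j hj
        simp only [Finset.mem_sdiff, Finset.mem_range] at hj
        rw [if_neg (by omega), zero_mul]
      · intro j hj
        simp only [Finset.mem_range] at hj
        rw [if_pos (by omega), mul_comm]
    rw [h2, h3, h, Pi.single_apply]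
    exact if_congr ⟨fun hi => Fin.ext hi, fun hi => congrArg Fin.val hi⟩ rfl rfl
  -- Cramer's rule: the last entry of the solution is (-1)^n times the minor without row 0 and the
  -- last column, which is the determinant in `D`.
  have hadj := congrArg ((toeplitz s (n + 1)).adjugate.mulVec) hmul
  rw [Matrix.mulVec_mulVec, Matrix.adjugate_mul, det_toeplitz, Matrix.smul_mulVec,
    Matrix.one_mulVec] at hadj
  have hlast := congrFun hadj (Fin.last n)
  rw [Matrix.mulVec_single_one, Matrix.col_apply,
    Matrix.adjugate_fin_succ_eq_det_submatrix] at hlast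
  simp only [Pi.smul_apply, Fin.val_last, smul_eq_mul, Fin.val_zero, zero_add, Fin.succAbove_last] at hlast
  have hsub : ((toeplitz s (n + 1)).submatrix (Fin.succAbove 0) Fin.castSucc)
      = Matrix.of fun i j : Fin n =>
      if (j : ℕ) ≤ (i : ℕ) + 1 then s ((i : ℕ) + 1 - (j : ℕ)) else 0 := by
    ext i j
    rfl
  rw [hsub] at hlast
  have hs' : s 0 ^ (n + 1) ≠ 0 := pow_ne_zero _ hs
  unfold D
  field_simp
  rw [← hlast, mul_comm]

/-! ### Generalized means of differences and the triangle E -/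

theorem sum_range_diff (x : ℕ → 𝕜) (n : ℕ) : ∑ k ∈ Finset.range (n + 1), diff x k = x n := by
  induction n with
  | zero => simp [diff]
  | succ n ih => rw [Finset.sum_range_succ, ih]; simp [diff]

theorem diff_sum_range (u : ℕ → 𝕜) :
    diff (fun n => ∑ k ∈ Finset.range (n + 1), u k) = u := by
  funext k
  cases k with
  | zero => simp [diff]
  | succ n => simp [diff, Finset.sum_range_succ _ (n + 1)]

theorem genMean_eq_coeff (r s t x : ℕ → 𝕜) (n : ℕ) :
    genMean r s t x n = 1 / r n *
      PowerSeries.coeff n (PowerSeries.mk (fun k => t k * x k) * PowerSeries.mk s) := by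
  rw [PowerSeries.coeff_mul, Finset.Nat.sum_antidiagonal_eq_sum_range_succ_mk, genMean]
  simp only [PowerSeries.coeff_mk]
  congr 1
  exact Finset.sum_congr rfl fun k _ => by ring

theorem exists_genMean_diff_eq (r s t : ℕ → 𝕜) (hr : ∀ n, r n ≠ 0) (ht : ∀ n, t n ≠ 0)
    (hs : s 0 ≠ 0) (y : ℕ → 𝕜) : ∃ x, genMean r s t (diff x) = y := by
  set P : PowerSeries 𝕜 := PowerSeries.mk (fun k => r k * y k) * (PowerSeries.mk s)⁻¹ with hP
  refine ⟨fun n => ∑ k ∈ Finset.range (n + 1), PowerSeries.coeff k P / t k, ?_⟩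
  funext n
  rw [diff_sum_range, genMean_eq_coeff]
  have : (PowerSeries.mk fun k => t k * (PowerSeries.coeff k P / t k)) = P := by
    ext k
    rw [PowerSeries.coeff_mk, mul_div_cancel₀ _ (ht k)]
  rw [this, hP, mul_assoc, PowerSeries.inv_mul_cancel _ (by simpa using hs), mul_one,
    PowerSeries.coeff_mk]
  have := hr n
  field_simp

theorem mul_diff_eq_sum (r s t : ℕ → 𝕜) (hr : ∀ n, r n ≠ 0) (hs : s 0 ≠ 0) (x : ℕ → 𝕜) (l : ℕ) :
    t l * diff x l = ∑ j ∈ Finset.range (l + 1),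
      r j * genMean r s t (diff x) j * ((-1) ^ (l - j) * D s (l - j)) := by
  have h : (PowerSeries.mk fun j => r j * genMean r s t (diff x) j)
      = PowerSeries.mk (fun k => t k * diff x k) * PowerSeries.mk s := by
    ext n
    rw [PowerSeries.coeff_mk, genMean_eq_coeff, ← mul_assoc, mul_one_div_cancel (hr n), one_mul]
  have h2 : PowerSeries.mk (fun k => t k * diff x k)
      = (PowerSeries.mk fun j => r j * genMean r s t (diff x) j) * (PowerSeries.mk s)⁻¹ := by
    rw [h, mul_assoc, PowerSeries.mul_inv_cancel _ (by simpa using hs), mul_one]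
  have h3 := congrArg (PowerSeries.coeff l) h2
  rw [PowerSeries.coeff_mul, Finset.Nat.sum_antidiagonal_eq_sum_range_succ_mk] at h3
  simpa only [PowerSeries.coeff_mk, coeff_inv_mk s hs] using h3

/-- The definition of `E` splits this sum: the l = k term gives a_k/(s_0 t_k) plus a tail over j >
k, and that tail is merged with the l = k + 1 term. -/
theorem E_eq_sum (r s t a : ℕ → 𝕜) {m k : ℕ} (hk : k ≤ m) :
    E r s t a m k = r k * ∑ l ∈ Finset.Icc k m,
      (-1) ^ (l - k) * (D s (l - k) / t l) * ∑ j ∈ Finset.Icc l m, a j := by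
  have hD : D s 0 = 1 / s 0 := by simp [D]
  rw [E, if_pos hk]
  congr 1
  have hsplit : ∀ (f : ℕ → 𝕜) (i : ℕ), i ≤ m →
      ∑ l ∈ Finset.Icc i m, f l = f i + ∑ l ∈ Finset.Icc (i + 1) m, f l := by
    intro f i hi
    rw [← Finset.insert_Icc_add_one_left_eq_Icc hi, Finset.sum_insert (by simp)]
  rw [hsplit (fun l => (-1) ^ (l - k) * (D s (l - k) / t l) * ∑ j ∈ Finset.Icc l m, a j) k hk,
    hsplit a k hk]
  have ha : a k / (s 0 * t k) = D s 0 / t k * a k := by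
    rw [hD, div_div, one_div, div_eq_inv_mul]
  rw [ha]
  rcases hk.eq_or_lt with rfl | hlt
  · simp
  · rw [hsplit (fun l => (-1) ^ (l - k) * (D s (l - k) / t l) * ∑ j ∈ Finset.Icc l m, a j)
      (k + 1) hlt]
    simp only [Nat.sub_self, pow_zero, add_tsub_cancel_left, pow_one]
    ring

/-- Partial sums of `∑ a_k x_k` in terms of the generalized means of the differences of `x`. -/
theorem sum_mul_eq_sum_E (r s t : ℕ → 𝕜) (hr : ∀ n, r n ≠ 0) (ht : ∀ n, t n ≠ 0)
    (hs : s 0 ≠ 0) (a x : ℕ → 𝕜) (m : ℕ) :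
    ∑ k ∈ Finset.range (m + 1), a k * x k
      = ∑ k ∈ Finset.range (m + 1), E r s t a m k * genMean r s t (diff x) k := by
  set y := genMean r s t (diff x) with hy
  have hdx : ∀ l, diff x l = ∑ j ∈ Finset.range (l + 1),
      (-1) ^ (l - j) * (D s (l - j) / t l) * (r j * y j) := by
    intro l
    have h := mul_diff_eq_sum r s t hr hs x l
    have : diff x l = (t l)⁻¹ * (t l * diff x l) := by rw [inv_mul_cancel_left₀ (ht l)]
    rw [this, h, Finset.mul_sum]
    exact Finset.sum_congr rfl fun j _ => by rw [← hy, div_eq_mul_inv]; ring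
  calc ∑ k ∈ Finset.range (m + 1), a k * x k
      = ∑ k ∈ Finset.range (m + 1), ∑ l ∈ Finset.range (k + 1), a k * diff x l :=
        Finset.sum_congr rfl fun k _ => by rw [← Finset.mul_sum, sum_range_diff]
    _ = ∑ l ∈ Finset.range (m + 1), ∑ k ∈ Finset.Icc l m, a k * diff x l := by
        apply Finset.sum_comm'
        intro k l
        simp only [Finset.mem_range, Finset.mem_Icc]
        omega
    _ = ∑ l ∈ Finset.range (m + 1), ∑ j ∈ Finset.range (l + 1),
          (∑ k ∈ Finset.Icc l m, a k) * ((-1) ^ (l - j) * (D s (l - j) / t l) * (r j * y j)) :=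
        Finset.sum_congr rfl fun l _ => by rw [← Finset.sum_mul, hdx, Finset.mul_sum]
    _ = ∑ j ∈ Finset.range (m + 1), ∑ l ∈ Finset.Icc j m,
          (∑ k ∈ Finset.Icc l m, a k) * ((-1) ^ (l - j) * (D s (l - j) / t l) * (r j * y j)) := by
        apply Finset.sum_comm'
        intro k l
        simp only [Finset.mem_range, Finset.mem_Icc]
        omega
    _ = _ := by
        refine Finset.sum_congr rfl fun j hj => ?_
        rw [E_eq_sum r s t a (Nat.lt_succ_iff.1 (Finset.mem_range.1 hj)), Finset.mul_sum,
          Finset.sum_mul]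
        exact Finset.sum_congr rfl fun l _ => by ring

/-! ### ℓ¹ functionals on the unit cube and Schur's theorem -/

theorem norm_mul_le_of_norm_le_one {a z : 𝕜} (hz : ‖z‖ ≤ 1) : ‖a * z‖ ≤ ‖a‖ := by
  rw [norm_mul]
  exact mul_le_of_le_one_right (norm_nonneg _) hz

theorem summable_mul_of_norm_le_one {f z : ℕ → 𝕜} (hf : Summable fun k => ‖f k‖)
    (hz : ∀ k, ‖z k‖ ≤ 1) : Summable fun k => f k * z k :=
  Summable.of_norm_bounded hf fun k => norm_mul_le_of_norm_le_one (hz k)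

theorem norm_tsum_mul_le {f z : ℕ → 𝕜} (hf : Summable fun k => ‖f k‖) (hz : ∀ k, ‖z k‖ ≤ 1) :
    ‖∑' k, f k * z k‖ ≤ ∑' k, ‖f k‖ :=
  tsum_of_norm_bounded hf.hasSum fun k => norm_mul_le_of_norm_le_one (hz k)

/-- The unit ball of the bounded sequences; it is compact in the product topology. -/
def unitCube (𝕜 : Type*) [RCLike 𝕜] : Set (ℕ → 𝕜) := {z | ∀ k, ‖z k‖ ≤ 1}

theorem isCompact_unitCube : IsCompact (unitCube 𝕜) := by
  have : unitCube 𝕜 = Set.univ.pi fun _ => Metric.closedBall (0 : 𝕜) 1 := by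
    ext z
    simp [unitCube]
  rw [this]
  exact isCompact_univ_pi fun _ => isCompact_closedBall _ _

theorem continuous_tsum_mul {f : ℕ → 𝕜} (hf : Summable fun k => ‖f k‖) :
    Continuous fun z : unitCube 𝕜 => ∑' k, f k * z.1 k :=
  continuous_tsum
    (fun k => continuous_const.mul ((continuous_apply k).comp continuous_subtype_val)) hf fun k z => norm_mul_le_of_norm_le_one (z.2 k)

/-- A Baire category argument on the unit cube: if countably many closed sets cover the cube, then
one of them contains points which nearly norm every `f ∈ ℓ¹`, up to finitely many coordinates. -/
theorem exists_nearly_norming {F : ℕ → Set (unitCube 𝕜)} (hF : ∀ m, IsClosed (F m))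
    (hcov : ∀ z, ∃ m, z ∈ F m) :
    ∃ (m : ℕ) (I : Finset ℕ), ∀ f : ℕ → 𝕜, (Summable fun k => ‖f k‖) →
      ∃ z ∈ F m, ∑' k, ‖f k‖ ≤ ‖∑' k, f k * z.1 k‖ + 2 * ∑ k ∈ I, ‖f k‖ := by
  classical
  have : CompactSpace (unitCube 𝕜) := isCompact_iff_compactSpace.1 isCompact_unitCube
  have : Nonempty (unitCube 𝕜) := ⟨⟨0, fun k => by simp⟩⟩
  obtain ⟨m, z₀, hz₀⟩ := nonempty_interior_of_iUnion_of_closed hF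
    (Set.eq_univ_of_forall fun z => Set.mem_iUnion.2 (hcov z))
  obtain ⟨O, hO, hOF⟩ := isOpen_induced_iff.1 (isOpen_interior (s := F m))
  have hz₀O : z₀.1 ∈ O := by
    rw [← hOF] at hz₀
    exact hz₀
  obtain ⟨I, u, hu, hIu⟩ := isOpen_pi_iff.1 hO z₀.1 hz₀O
  refine ⟨m, I, fun f hf => ?_⟩
  -- A basic neighbourhood of z₀ restricts only the coordinates in I. Off I the conjugate phase
  -- makes f_k z_k = |f_k|; where f_k = 0, division by zero gives z_k = 0.
  set z : ℕ → 𝕜 := fun k => if k ∈ I then z₀.1 k else (starRingEnd 𝕜) (f k) / (‖f k‖ : 𝕜) with hz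
  have hz1 : ∀ k, ‖z k‖ ≤ 1 := by
    intro k
    by_cases hk : k ∈ I
    · simpa [hz, hk] using z₀.2 k
    · simp only [hz, hk, if_false, norm_div, RCLike.norm_conj, RCLike.norm_ofReal, abs_norm]
      exact div_self_le_one _
  have hzO : z ∈ O := by
    refine hIu fun k hk => ?_
    have hk' : k ∈ I := hk
    simpa [hz, hk'] using (hu k hk).2
  refine ⟨⟨z, hz1⟩, interior_subset (hOF ▸ hzO : (⟨z, hz1⟩ : unitCube 𝕜) ∈ interior (F m)), ?_⟩
  have hs1 : Summable fun k => ((‖f k‖ : ℝ) : 𝕜) := by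
    simpa using (RCLike.ofRealCLM (K := 𝕜)).summable hf
  have hs2 := summable_mul_of_norm_le_one hf hz1
  have hzero : ∀ k ∉ I, ((‖f k‖ : ℝ) : 𝕜) - f k * z k = 0 := by
    intro k hk
    simp only [hz, hk, if_false]
    by_cases h0 : f k = 0
    · simp [h0]
    · have h1 : ((‖f k‖ : ℝ) : 𝕜) ≠ 0 := by simpa using h0
      rw [← mul_div_assoc, RCLike.mul_conj]
      field_simp
      ring
  have hsub : ∑' k, ((‖f k‖ : ℝ) : 𝕜) - ∑' k, f k * z k
      = ∑ k ∈ I, (((‖f k‖ : ℝ) : 𝕜) - f k * z k) := by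
    rw [← hs1.tsum_sub hs2]
    exact tsum_eq_sum hzero
  have hle : ‖∑' k, ((‖f k‖ : ℝ) : 𝕜) - ∑' k, f k * z k‖ ≤ 2 * ∑ k ∈ I, ‖f k‖ := by
    rw [hsub, Finset.mul_sum]
    refine norm_sum_le_of_le _ fun k _ => (norm_sub_le _ _).trans ?_
    have := norm_mul_le_of_norm_le_one (a := f k) (hz1 k)
    simp only [RCLike.norm_ofReal, abs_norm]
    linarith
  have hnorm : ‖∑' k, ((‖f k‖ : ℝ) : 𝕜)‖ = ∑' k, ‖f k‖ := by
    rw [← RCLike.ofReal_tsum, RCLike.norm_ofReal, abs_of_nonneg (tsum_nonneg fun k => norm_nonneg _)]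
  rw [← hnorm]
  have := norm_sub_norm_le (∑' k, ((‖f k‖ : ℝ) : 𝕜)) (∑' k, f k * z k)
  linarith

theorem tsum_mul_single (f : ℕ → 𝕜) (k : ℕ) :
    ∑' j, f j * (Pi.single k 1 : ℕ → 𝕜) j = f k := by
  rw [tsum_eq_single k fun j hj => by simp [hj]]
  simp

theorem norm_single_one_le (k j : ℕ) : ‖(Pi.single k 1 : ℕ → 𝕜) j‖ ≤ 1 := by
  by_cases h : j = k
  · subst h; simp
  · simp [h]

/-- Schur's theorem: a sequence in `ℓ¹` that converges when tested against each bounded sequence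
converges in norm. -/
theorem exists_tendsto_tsum_norm_sub {f : ℕ → ℕ → 𝕜} (hf : ∀ n, Summable fun k => ‖f n k‖)
    (hconv : ∀ z : ℕ → 𝕜, (∀ k, ‖z k‖ ≤ 1) →
      ∃ l, Tendsto (fun n => ∑' k, f n k * z k) atTop (𝓝 l)) :
    ∃ β : ℕ → 𝕜, (∀ k, Tendsto (fun n => f n k) atTop (𝓝 (β k))) ∧
      (Summable fun k => ‖β k‖) ∧ Tendsto (fun n => ∑' k, ‖f n k - β k‖) atTop (𝓝 0) := by
  have hcol : ∀ k, ∃ l, Tendsto (fun n => f n k) atTop (𝓝 l) := fun k => by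
    simpa only [tsum_mul_single] using hconv (Pi.single k 1) (norm_single_one_le k)
  choose β hβ using hcol
  have hsub : ∀ n n', Summable fun k => ‖f n k - f n' k‖ := fun n n' =>
    Summable.of_nonneg_of_le (fun _ => norm_nonneg _) (fun _ => norm_sub_le _ _)
      ((hf n).add (hf n'))
  have hcauchy : ∀ ε > 0, ∃ m, ∀ n ≥ m, ∀ n' ≥ m, ∑' k, ‖f n k - f n' k‖ ≤ ε := by
    intro ε hε
    set F : ℕ → Set (unitCube 𝕜) := fun m =>
      ⋂ n ≥ m, ⋂ n' ≥ m, {z | ‖∑' k, f n k * z.1 k - ∑' k, f n' k * z.1 k‖ ≤ ε / 2} with hFdef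
    have hF : ∀ m, IsClosed (F m) := fun m =>
      isClosed_iInter fun n => isClosed_iInter fun _ => isClosed_iInter fun n' =>
        isClosed_iInter fun _ => isClosed_le
          ((continuous_tsum_mul (hf n)).sub (continuous_tsum_mul (hf n'))).norm continuous_const
    have hcov : ∀ z, ∃ m, z ∈ F m := by
      intro z
      obtain ⟨l, hl⟩ := hconv z.1 z.2
      obtain ⟨m, hm⟩ := Metric.cauchySeq_iff.1 hl.cauchySeq (ε / 2) (half_pos hε)
      refine ⟨m, ?_⟩
      simp only [hFdef, Set.mem_iInter, Set.mem_ofPred_eq]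
      intro n hn n' hn'
      rw [← dist_eq_norm]
      exact (hm n hn n' hn').le
    obtain ⟨m, I, hI⟩ := exists_nearly_norming hF hcov
    have hfin : Tendsto (fun n => ∑ k ∈ I, ‖f n k - β k‖) atTop (𝓝 0) := by
      have := tendsto_finsetSum I fun k _ => ((hβ k).sub_const (β k)).norm
      simpa using this
    -- Budget: ε/2 from membership in F m, plus 2(ε/8 + ε/8) from the coordinates in I.
    obtain ⟨m', hm'⟩ := eventually_atTop.1 (hfin.eventually_le_const (show 0 < ε / 8 by positivity))
    refine ⟨max m m', fun n hn n' hn' => ?_⟩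
    obtain ⟨z, hz, hle⟩ := hI (fun k => f n k - f n' k) (hsub n n')
    simp only [hFdef, Set.mem_iInter, Set.mem_ofPred_eq] at hz
    have h1 := hz n (le_of_max_le_left hn) n' (le_of_max_le_left hn')
    have h2 : ∑' k, (f n k - f n' k) * z.1 k = ∑' k, f n k * z.1 k - ∑' k, f n' k * z.1 k := by
      rw [← (summable_mul_of_norm_le_one (hf n) z.2).tsum_sub
        (summable_mul_of_norm_le_one (hf n') z.2)]
      simp only [sub_mul]
    have h3 : ∑ k ∈ I, ‖f n k - f n' k‖ ≤ ∑ k ∈ I, ‖f n k - β k‖ + ∑ k ∈ I, ‖f n' k - β k‖ := by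
      rw [← Finset.sum_add_distrib]
      refine Finset.sum_le_sum fun k _ => ?_
      rw [norm_sub_rev (f n' k)]
      exact norm_sub_le_norm_sub_add_norm_sub _ _ _
    have h4 := hm' n (le_of_max_le_right hn)
    have h5 := hm' n' (le_of_max_le_right hn')
    rw [h2] at hle
    linarith
  -- Finite sums are used because the summability of β is only deduced from this bound.
  have hlim : ∀ ε > 0, ∃ m, ∀ n ≥ m, ∀ K : Finset ℕ, ∑ k ∈ K, ‖f n k - β k‖ ≤ ε := by
    intro ε hε
    obtain ⟨m, hm⟩ := hcauchy ε hε
    refine ⟨m, fun n hn K => ?_⟩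
    have ht : Tendsto (fun n' => ∑ k ∈ K, ‖f n k - f n' k‖) atTop
        (𝓝 (∑ k ∈ K, ‖f n k - β k‖)) :=
      tendsto_finsetSum K fun k _ => ((hβ k).const_sub (f n k)).norm
    refine le_of_tendsto ht (eventually_atTop.2 ⟨m, fun n' hn' => ?_⟩)
    exact ((hsub n n').sum_le_tsum K fun _ _ => norm_nonneg _).trans (hm n hn n' hn')
  have hβsum : Summable fun k => ‖β k‖ := by
    obtain ⟨m, hm⟩ := hlim 1 one_pos
    have h1 : Summable fun k => ‖f m k - β k‖ :=
      summable_of_sum_le (fun _ => norm_nonneg _) (hm m le_rfl)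
    refine Summable.of_nonneg_of_le (fun _ => norm_nonneg _) (fun k => ?_) ((hf m).add h1)
    simpa using norm_sub_le (f m k) (f m k - β k)
  refine ⟨β, hβ, hβsum, ?_⟩
  rw [Metric.tendsto_atTop]
  intro ε hε
  obtain ⟨m, hm⟩ := hlim (ε / 2) (half_pos hε)
  refine ⟨m, fun n hn => ?_⟩
  rw [Real.dist_eq, sub_zero, abs_of_nonneg (tsum_nonneg fun _ => norm_nonneg _)]
  have := Real.tsum_le_of_sum_le (fun k => norm_nonneg (f n k - β k)) (hm n hn)
  linarith

/-! ### Inequalities uniform in exponents q ≤ Q -/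

theorem add_rpow_le_two_rpow_mul {u v q Q : ℝ} (hu : 0 ≤ u) (hv : 0 ≤ v) (hq : 0 < q)
    (hQ : q ≤ Q) : (u + v) ^ q ≤ 2 ^ Q * (u ^ q + v ^ q) := by
  have hmax : 0 ≤ max u v := hu.trans (le_max_left _ _)
  have h1 : u + v ≤ 2 * max u v := by linarith [le_max_left u v, le_max_right u v]
  have h2 : (max u v) ^ q ≤ u ^ q + v ^ q := by
    have := Real.rpow_nonneg hu q
    have := Real.rpow_nonneg hv q
    rcases max_choice u v with h | h <;> rw [h] <;> linarith
  calc (u + v) ^ q ≤ (2 * max u v) ^ q := Real.rpow_le_rpow (add_nonneg hu hv) h1 hq.le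
    _ = 2 ^ q * (max u v) ^ q := Real.mul_rpow zero_le_two hmax
    _ ≤ 2 ^ Q * (u ^ q + v ^ q) :=
        mul_le_mul (Real.rpow_le_rpow_of_exponent_le one_le_two hQ) h2
          (Real.rpow_nonneg hmax q) (by positivity)

theorem sum_rpow_le {ι : Type*} (I : Finset ι) {q Q : ℝ} (hq : 0 < q) (hQ : q ≤ Q) {b : ι → ℝ}
    (hb : ∀ k, 0 ≤ b k) :
    (∑ k ∈ I, b k) ^ q ≤ (2 ^ Q) ^ I.card * ∑ k ∈ I, b k ^ q := by
  classical
  induction I using Finset.induction_on with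
  | empty => simp [Real.zero_rpow hq.ne']
  | insert i I hi ih =>
    rw [Finset.sum_insert hi, Finset.sum_insert hi, Finset.card_insert_of_notMem hi, pow_succ']
    have h1 : (1 : ℝ) ≤ 2 ^ Q := Real.one_le_rpow one_le_two (hq.le.trans hQ)
    have h2 : (1 : ℝ) ≤ (2 ^ Q) ^ I.card := one_le_pow₀ h1
    have h3 : b i ^ q ≤ (2 ^ Q) ^ I.card * b i ^ q :=
      le_mul_of_one_le_left (Real.rpow_nonneg (hb i) q) h2
    calc _ ≤ 2 ^ Q * (b i ^ q + (∑ k ∈ I, b k) ^ q) :=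
          add_rpow_le_two_rpow_mul (hb i) (Finset.sum_nonneg fun k _ => hb k) hq hQ
      _ ≤ 2 ^ Q * ((2 ^ Q) ^ I.card * b i ^ q + (2 ^ Q) ^ I.card * ∑ k ∈ I, b k ^ q) := by
          gcongr
      _ = _ := by ring

theorem le_add_two_mul_sum_rpow {ι : Type*} (I : Finset ι) {q Q T a : ℝ} (hq : 0 < q)
    (hQ : q ≤ Q) (hT : 0 ≤ T) (ha : 0 ≤ a) {b : ι → ℝ} (hb : ∀ k, 0 ≤ b k)
    (h : T ≤ a + 2 * ∑ k ∈ I, b k) :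
    T ^ q ≤ 2 ^ Q * (a ^ q + 2 ^ Q * ((2 ^ Q) ^ I.card * ∑ k ∈ I, b k ^ q)) := by
  have hS : 0 ≤ ∑ k ∈ I, b k := Finset.sum_nonneg fun k _ => hb k
  calc T ^ q ≤ (a + 2 * ∑ k ∈ I, b k) ^ q := Real.rpow_le_rpow hT h hq.le
    _ ≤ 2 ^ Q * (a ^ q + (2 * ∑ k ∈ I, b k) ^ q) :=
        add_rpow_le_two_rpow_mul ha (by positivity) hq hQ
    _ ≤ _ := by
        rw [Real.mul_rpow zero_le_two hS]
        gcongr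
        · exact one_le_two
        · exact sum_rpow_le I hq hQ hb

/-- For δ ≤ 1 and q_n ≤ Q one has δ^{q_n} ≥ δ^Q, so the powers can only become small if the bases
do. The converse fails when q_n → 0. -/
theorem tendsto_zero_of_rpow {u q : ℕ → ℝ} (hu : ∀ n, 0 ≤ u n) (hq : ∀ n, 0 < q n)
    (hq' : BddAbove (Set.range q)) (h : Tendsto (fun n => u n ^ q n) atTop (𝓝 0)) :
    Tendsto u atTop (𝓝 0) := by
  obtain ⟨Q, hQ⟩ := hq'
  rw [Metric.tendsto_atTop]
  intro ε hε
  set δ := min ε 1 with hδ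
  have hδ0 : 0 < δ := lt_min hε one_pos
  obtain ⟨m, hm⟩ := eventually_atTop.1 (h.eventually_lt_const (Real.rpow_pos_of_pos hδ0 Q))
  refine ⟨m, fun n hn => ?_⟩
  rw [Real.dist_eq, sub_zero, abs_of_nonneg (hu n)]
  refine lt_of_lt_of_le ?_ (min_le_left ε 1)
  by_contra! hle
  have h1 : δ ^ q n ≤ u n ^ q n := Real.rpow_le_rpow hδ0.le hle (hq n).le
  have h2 : δ ^ Q ≤ δ ^ q n :=
    Real.rpow_le_rpow_of_exponent_ge hδ0 (min_le_right _ _) (hQ ⟨n, rfl⟩)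
  linarith [hm n hn]

/-! ### Norm bounds and limits with variable exponents -/

section UnitCube

variable {f : ℕ → ℕ → 𝕜} {q : ℕ → ℝ}

theorem isClosed_rpow_norm_tsum_le {g : ℕ → 𝕜} (hg : Summable fun k => ‖g k‖) {a : ℝ} (ha : 0 < a)
    (ε : ℝ) : IsClosed {z : unitCube 𝕜 | ‖∑' k, g k * z.1 k‖ ^ a ≤ ε} :=
  isClosed_le ((continuous_tsum_mul hg).norm.rpow_const fun _ => Or.inr ha.le) continuous_const

theorem tendsto_tsum_norm_rpow (hf : ∀ n, Summable fun k => ‖f n k‖) (hq : ∀ n, 0 < q n)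
    (hq' : BddAbove (Set.range q))
    (h : ∀ z : ℕ → 𝕜, (∀ k, ‖z k‖ ≤ 1) →
      Tendsto (fun n => ‖∑' k, f n k * z k‖ ^ q n) atTop (𝓝 0)) :
    Tendsto (fun n => (∑' k, ‖f n k‖) ^ q n) atTop (𝓝 0) := by
  obtain ⟨Q, hQ⟩ := hq'
  have hcol : ∀ k, Tendsto (fun n => ‖f n k‖ ^ q n) atTop (𝓝 0) := fun k => by
    simpa only [tsum_mul_single] using h (Pi.single k 1) (norm_single_one_le k)
  have hT : ∀ n, 0 ≤ ∑' k, ‖f n k‖ := fun n => tsum_nonneg fun _ => norm_nonneg _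
  rw [Metric.tendsto_atTop]
  intro ε hε
  -- `le_add_two_mul_sum_rpow` bounds the power by 2^Q times two contributions, each at most δ.
  set δ := ε / (2 * 2 ^ Q) with hδ
  have hδ0 : 0 < δ := by positivity
  set F : ℕ → Set (unitCube 𝕜) := fun m =>
    ⋂ n ≥ m, {z | ‖∑' k, f n k * z.1 k‖ ^ q n ≤ δ} with hFdef
  have hF : ∀ m, IsClosed (F m) := fun m =>
    isClosed_iInter fun n => isClosed_iInter fun _ => isClosed_rpow_norm_tsum_le (hf n) (hq n) _
  have hcov : ∀ z, ∃ m, z ∈ F m := by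
    intro z
    obtain ⟨m, hm⟩ := eventually_atTop.1 ((h z.1 z.2).eventually_le_const hδ0)
    exact ⟨m, by simpa only [hFdef, Set.mem_iInter, Set.mem_ofPred_eq] using hm⟩
  obtain ⟨m, I, hI⟩ := exists_nearly_norming hF hcov
  have hfin : Tendsto (fun n => 2 ^ Q * ((2 ^ Q) ^ I.card * ∑ k ∈ I, ‖f n k‖ ^ q n)) atTop
      (𝓝 0) := by
    have := ((tendsto_finsetSum I fun k _ => hcol k).const_mul ((2 ^ Q) ^ I.card)).const_mul
      ((2 : ℝ) ^ Q)
    simpa using this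
  obtain ⟨m', hm'⟩ := eventually_atTop.1 (hfin.eventually_lt_const hδ0)
  refine ⟨max m m', fun n hn => ?_⟩
  rw [Real.dist_eq, sub_zero, abs_of_nonneg (Real.rpow_nonneg (hT n) _)]
  obtain ⟨z, hz, hle⟩ := hI (f n) (hf n)
  simp only [hFdef, Set.mem_iInter, Set.mem_ofPred_eq] at hz
  have h1 := hz n (le_of_max_le_left hn)
  have h2 := hm' n (le_of_max_le_right hn)
  have h3 := le_add_two_mul_sum_rpow I (hq n) (hQ ⟨n, rfl⟩) (hT n) (norm_nonneg _)
    (fun k => norm_nonneg _) hle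
  have h4 : (2 : ℝ) ^ Q * (2 * δ) = ε := by
    rw [hδ]
    field_simp
  refine h3.trans_lt ?_
  rw [← h4]
  gcongr
  linarith

theorem bddAbove_tsum_norm_rpow (hf : ∀ n, Summable fun k => ‖f n k‖) (hq : ∀ n, 0 < q n)
    (hq' : BddAbove (Set.range q))
    (h : ∀ z : ℕ → 𝕜, (∀ k, ‖z k‖ ≤ 1) →
      BddAbove (Set.range fun n => ‖∑' k, f n k * z k‖ ^ q n)) :
    BddAbove (Set.range fun n => (∑' k, ‖f n k‖) ^ q n) := by
  obtain ⟨Q, hQ⟩ := hq'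
  have hcol : ∀ k, ∃ M, ∀ n, ‖f n k‖ ^ q n ≤ M := fun k => by
    obtain ⟨M, hM⟩ := h (Pi.single k 1) (norm_single_one_le k)
    refine ⟨M, fun n => ?_⟩
    simpa only [tsum_mul_single] using hM ⟨n, rfl⟩
  choose G hG using hcol
  set F : ℕ → Set (unitCube 𝕜) := fun m =>
    ⋂ n, {z | ‖∑' k, f n k * z.1 k‖ ^ q n ≤ m} with hFdef
  have hF : ∀ m, IsClosed (F m) := fun m =>
    isClosed_iInter fun n => isClosed_rpow_norm_tsum_le (hf n) (hq n) _
  have hcov : ∀ z, ∃ m, z ∈ F m := by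
    intro z
    obtain ⟨M, hM⟩ := h z.1 z.2
    obtain ⟨m, hm⟩ := exists_nat_ge M
    refine ⟨m, ?_⟩
    simp only [hFdef, Set.mem_iInter, Set.mem_ofPred_eq]
    exact fun n => (hM ⟨n, rfl⟩).trans hm
  obtain ⟨m, I, hI⟩ := exists_nearly_norming hF hcov
  refine ⟨2 ^ Q * (m + 2 ^ Q * ((2 ^ Q) ^ I.card * ∑ k ∈ I, G k)), ?_⟩
  rintro _ ⟨n, rfl⟩
  obtain ⟨z, hz, hle⟩ := hI (f n) (hf n)
  simp only [hFdef, Set.mem_iInter, Set.mem_ofPred_eq] at hz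
  have h1 := hz n
  refine (le_add_two_mul_sum_rpow I (hq n) (hQ ⟨n, rfl⟩) (tsum_nonneg fun _ => norm_nonneg _)
    (norm_nonneg _) (fun k => norm_nonneg _) hle).trans ?_
  gcongr with k
  exact hG k n

theorem tendsto_tsum_mul_of_tendsto_tsum_norm_sub {β : ℕ → 𝕜}
    (hf : ∀ n, Summable fun k => ‖f n k‖) (hβ : Summable fun k => ‖β k‖)
    (h : Tendsto (fun n => ∑' k, ‖f n k - β k‖) atTop (𝓝 0)) {z : ℕ → 𝕜} (hz : ∀ k, ‖z k‖ ≤ 1) :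
    Tendsto (fun n => ∑' k, f n k * z k) atTop (𝓝 (∑' k, β k * z k)) := by
  rw [tendsto_iff_norm_sub_tendsto_zero]
  refine squeeze_zero (fun _ => norm_nonneg _) (fun n => ?_) h
  rw [← (summable_mul_of_norm_le_one (hf n) hz).tsum_sub (summable_mul_of_norm_le_one hβ hz)]
  simp only [← sub_mul]
  exact norm_tsum_mul_le (Summable.of_nonneg_of_le (fun _ => norm_nonneg _)
    (fun _ => norm_sub_le _ _) ((hf n).add hβ)) hz

/-- Schur's theorem produces β and forces each limit l to be ∑ β_k z_k. The null version
`tendsto_tsum_norm_rpow`, applied to f_n - β, then restores the exponents. -/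
theorem exists_tendsto_tsum_norm_sub_rpow (hf : ∀ n, Summable fun k => ‖f n k‖)
    (hq : ∀ n, 0 < q n) (hq' : BddAbove (Set.range q))
    (h : ∀ z : ℕ → 𝕜, (∀ k, ‖z k‖ ≤ 1) →
      ∃ l, Tendsto (fun n => ‖∑' k, f n k * z k - l‖ ^ q n) atTop (𝓝 0)) :
    ∃ β : ℕ → 𝕜, (∀ k, Tendsto (fun n => f n k) atTop (𝓝 (β k))) ∧
      (Summable fun k => ‖β k‖) ∧ Tendsto (fun n => ∑' k, ‖f n k - β k‖) atTop (𝓝 0) ∧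
      Tendsto (fun n => (∑' k, ‖f n k - β k‖) ^ q n) atTop (𝓝 0) := by
  have hlim : ∀ z : ℕ → 𝕜, ∀ l, Tendsto (fun n => ‖∑' k, f n k * z k - l‖ ^ q n) atTop (𝓝 0) →
      Tendsto (fun n => ∑' k, f n k * z k) atTop (𝓝 l) := fun z l hl =>
    tendsto_iff_norm_sub_tendsto_zero.2
      (tendsto_zero_of_rpow (fun _ => norm_nonneg _) hq hq' hl)
  obtain ⟨β, hβ, hβs, hβ1⟩ := exists_tendsto_tsum_norm_sub hf fun z hz =>
    (h z hz).imp fun l hl => hlim z l hl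
  refine ⟨β, hβ, hβs, hβ1, tendsto_tsum_norm_rpow (fun n => ?_) hq hq' fun z hz => ?_⟩
  · exact Summable.of_nonneg_of_le (fun _ => norm_nonneg _) (fun _ => norm_sub_le _ _)
      ((hf n).add hβs)
  · obtain ⟨l, hl⟩ := h z hz
    have hl' : l = ∑' k, β k * z k := tendsto_nhds_unique (hlim z l hl)
      (tendsto_tsum_mul_of_tendsto_tsum_norm_sub hf hβs hβ1 hz)
    rw [hl'] at hl
    refine hl.congr fun n => ?_
    rw [← (summable_mul_of_norm_le_one (hf n) hz).tsum_sub (summable_mul_of_norm_le_one hβs hz)]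
    simp only [← sub_mul]

end UnitCube

/-! ### l_∞(p) as a union of weighted unit cubes -/

/-- The weight `N^{1/p_k}`. -/
noncomputable def weight (p : ℕ → ℝ) (N k : ℕ) : ℝ := (N : ℝ) ^ (1 / p k)

theorem weight_pos (p : ℕ → ℝ) {N : ℕ} (hN : 1 ≤ N) (k : ℕ) : 0 < weight p N k :=
  Real.rpow_pos_of_pos (by exact_mod_cast hN) _

theorem weight_one (p : ℕ → ℝ) (k : ℕ) : weight p 1 k = 1 := by simp [weight]

theorem norm_mul_weight (p : ℕ → ℝ) {N : ℕ} (hN : 1 ≤ N) (u : 𝕜) (k : ℕ) :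
    ‖u * (weight p N k : 𝕜)‖ = ‖u‖ * weight p N k := by
  rw [norm_mul, RCLike.norm_ofReal, abs_of_pos (weight_pos p hN k)]

theorem weight_mul_mem_lInfty {p : ℕ → ℝ} (hp : ∀ k, 0 < p k) {N : ℕ} (hN : 1 ≤ N) {z : ℕ → 𝕜}
    (hz : ∀ k, ‖z k‖ ≤ 1) : (fun k => (weight p N k : 𝕜) * z k) ∈ lInfty p := by
  refine ⟨N, ?_⟩
  rintro _ ⟨k, rfl⟩
  have hw := weight_pos p hN k
  have h1 : ‖(weight p N k : 𝕜) * z k‖ ≤ weight p N k := by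
    rw [mul_comm, norm_mul_weight p hN]
    exact mul_le_of_le_one_left hw.le (hz k)
  refine (Real.rpow_le_rpow (norm_nonneg _) h1 (hp k).le).trans_eq ?_
  rw [weight, ← Real.rpow_mul (Nat.cast_nonneg _), one_div_mul_cancel (hp k).ne', Real.rpow_one]

theorem exists_weight_mul_eq {p : ℕ → ℝ} (hp : ∀ k, 0 < p k) {y : ℕ → 𝕜} (hy : y ∈ lInfty p) :
    ∃ N : ℕ, 1 ≤ N ∧ ∃ z : ℕ → 𝕜, (∀ k, ‖z k‖ ≤ 1) ∧ y = fun k => (weight p N k : 𝕜) * z k := by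
  obtain ⟨M, hM⟩ := hy
  obtain ⟨N, hN⟩ := exists_nat_ge (max M 1)
  have hN1 : 1 ≤ N := by exact_mod_cast (le_max_right M 1).trans hN
  refine ⟨N, hN1, fun k => y k / (weight p N k : 𝕜), fun k => ?_, ?_⟩
  · have hw := weight_pos p hN1 k
    rw [norm_div, RCLike.norm_ofReal, abs_of_pos hw, div_le_one hw, weight]
    have h1 : ‖y k‖ ^ p k ≤ N := (hM ⟨k, rfl⟩).trans ((le_max_left _ _).trans hN)
    have h2 := Real.rpow_le_rpow (Real.rpow_nonneg (norm_nonneg _) _) h1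
      (one_div_pos.2 (hp k)).le
    rwa [← Real.rpow_mul (norm_nonneg _), mul_one_div_cancel (hp k).ne', Real.rpow_one] at h2
  · funext k
    have hw : (weight p N k : 𝕜) ≠ 0 := by exact_mod_cast (weight_pos p hN1 k).ne'
    field_simp

/-! ### Reduction to the matrix Ẽ acting on l_∞(p) -/

theorem mem_lInftyMeanDiff_iff {r s t x : ℕ → 𝕜} {p : ℕ → ℝ} :
    x ∈ lInftyMeanDiff r s t p ↔ genMean r s t (diff x) ∈ lInfty p := Iff.rfl

/-- If `a` lies in the β-dual of `l_∞(r, s, t, p; Δ)`, then the columns of the associated triangle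
converge, and the limits represent the functional `x ↦ ∑ a_k x_k`. -/
theorem exists_limit_row {r s t : ℕ → 𝕜} {p : ℕ → ℝ} (hr : ∀ n, r n ≠ 0) (ht : ∀ n, t n ≠ 0)
    (hs : s 0 ≠ 0) (hp : ∀ k, 0 < p k) {a : ℕ → 𝕜} (ha : a ∈ betaDual (lInftyMeanDiff r s t p)) :
    ∃ e : ℕ → 𝕜, (∀ k, Tendsto (fun m => E r s t a m k) atTop (𝓝 (e k))) ∧
      (∀ N : ℕ, 1 ≤ N → Summable fun k => ‖e k‖ * weight p N k) ∧
      ∀ x ∈ lInftyMeanDiff r s t p,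
        SeriesTendsto (fun k => a k * x k) (∑' k, e k * genMean r s t (diff x) k) := by
  have hzero : ∀ m, ∀ k ∉ Finset.range (m + 1), E r s t a m k = 0 := by
    intro m k hk
    rw [E, if_neg (by simpa [Nat.lt_succ_iff] using hk)]
  have hpart : ∀ (x : ℕ → 𝕜) (m : ℕ), ∑ k ∈ Finset.range (m + 1), a k * x k
      = ∑' k, E r s t a m k * genMean r s t (diff x) k := by
    intro x m
    rw [sum_mul_eq_sum_E r s t hr ht hs a x m, tsum_eq_sum]
    intro k hk
    rw [hzero m k hk, zero_mul]
  have hsummable : ∀ N m, Summable fun k => ‖E r s t a m k * (weight p N k : 𝕜)‖ := fun N m =>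
    summable_of_ne_finset_zero (s := Finset.range (m + 1)) fun k hk => by simp [hzero m k hk]
  have hschur : ∀ N : ℕ, 1 ≤ N → ∃ β : ℕ → 𝕜,
      (∀ k, Tendsto (fun m => E r s t a m k * (weight p N k : 𝕜)) atTop (𝓝 (β k))) ∧
      (Summable fun k => ‖β k‖) ∧
      Tendsto (fun m => ∑' k, ‖E r s t a m k * (weight p N k : 𝕜) - β k‖) atTop (𝓝 0) := by
    intro N hN
    refine exists_tendsto_tsum_norm_sub (hsummable N) fun z hz => ?_
    obtain ⟨x, hx⟩ := exists_genMean_diff_eq r s t hr ht hs fun k => (weight p N k : 𝕜) * z k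
    have hxU : x ∈ lInftyMeanDiff r s t p := by
      rw [mem_lInftyMeanDiff_iff, hx]
      exact weight_mul_mem_lInfty hp hN hz
    obtain ⟨l, hl⟩ := ha x hxU
    refine ⟨l, ((tendsto_add_atTop_iff_nat 1).2 hl).congr fun m => ?_⟩
    rw [hpart, hx]
    simp only [mul_assoc]
  -- For N = 1 the weight is 1, so this gives the column limits themselves. By uniqueness of limits
  -- the same e serves every N.
  obtain ⟨e, he, -, -⟩ := hschur 1 le_rfl
  simp only [weight_one, RCLike.ofReal_one, mul_one] at he
  have hβ : ∀ N : ℕ, 1 ≤ N → (Summable fun k => ‖e k * (weight p N k : 𝕜)‖) ∧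
      Tendsto (fun m => ∑' k, ‖E r s t a m k * (weight p N k : 𝕜) - e k * (weight p N k : 𝕜)‖)
        atTop (𝓝 0) := by
    intro N hN
    obtain ⟨β, h1, h2, h3⟩ := hschur N hN
    have : β = fun k => e k * (weight p N k : 𝕜) :=
      funext fun k => tendsto_nhds_unique (h1 k) ((he k).mul_const _)
    subst this
    exact ⟨h2, h3⟩
  refine ⟨e, he, fun N hN => ?_, fun x hx => ?_⟩
  · simpa only [norm_mul_weight p hN] using (hβ N hN).1
  · obtain ⟨N, hN, z, hz, hy⟩ :=
      exists_weight_mul_eq hp (mem_lInftyMeanDiff_iff.1 hx)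
    refine (tendsto_add_atTop_iff_nat 1).1 ?_
    refine Tendsto.congr (fun m => (hpart x m).symm) ?_
    rw [hy]
    simp only [← mul_assoc]
    exact tendsto_tsum_mul_of_tendsto_tsum_norm_sub (hsummable N) (hβ N hN).1 (hβ N hN).2 hz

theorem ETilde_spec {r s t : ℕ → 𝕜} {p : ℕ → ℝ} (hr : ∀ n, r n ≠ 0) (ht : ∀ n, t n ≠ 0)
    (hs : s 0 ≠ 0) (hp : ∀ k, 0 < p k) {A : ℕ → ℕ → 𝕜} {n : ℕ}
    (ha : A n ∈ betaDual (lInftyMeanDiff r s t p)) :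
    (∀ k, Tendsto (fun m => E r s t (A n) m k) atTop (𝓝 (ETilde r s t A n k))) ∧
      (∀ N : ℕ, 1 ≤ N → Summable fun k => ‖ETilde r s t A n k‖ * weight p N k) ∧
      ∀ x ∈ lInftyMeanDiff r s t p, SeriesTendsto (fun k => A n k * x k)
        (∑' k, ETilde r s t A n k * genMean r s t (diff x) k) := by
  obtain ⟨e, he, h⟩ := exists_limit_row hr ht hs hp ha
  have : ETilde r s t A n = e := funext fun k => (he k).limUnder_eq
  rw [this]
  exact ⟨he, h⟩

/-- Every y in l_∞(p) is the mean of some x in the domain, and Ax = Ẽy once the rows lie in the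
β-dual. -/
theorem mem_matrixClass_iff {r s t : ℕ → 𝕜} {p : ℕ → ℝ} (hr : ∀ n, r n ≠ 0) (ht : ∀ n, t n ≠ 0)
    (hs : s 0 ≠ 0) (hp : ∀ k, 0 < p k) (A : ℕ → ℕ → 𝕜) (V : Set (ℕ → 𝕜)) :
    A ∈ matrixClass (lInftyMeanDiff r s t p) V ↔
      (∀ n, A n ∈ betaDual (lInftyMeanDiff r s t p)) ∧
        ∀ y ∈ lInfty p, (fun n => ∑' k, ETilde r s t A n k * y k) ∈ V := by
  constructor
  · intro hA
    have hR : ∀ n, A n ∈ betaDual (lInftyMeanDiff r s t p) := fun n x hx => by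
      obtain ⟨y, -, hy⟩ := hA x hx
      exact ⟨y n, hy n⟩
    refine ⟨hR, fun y hy => ?_⟩
    obtain ⟨x, rfl⟩ := exists_genMean_diff_eq r s t hr ht hs y
    obtain ⟨v, hv, hAv⟩ := hA x hy
    have : v = fun n => ∑' k, ETilde r s t A n k * genMean r s t (diff x) k :=
      funext fun n => tendsto_nhds_unique (hAv n) ((ETilde_spec hr ht hs hp (hR n)).2.2 x hy)
    rwa [← this]
  · rintro ⟨hR, h⟩ x hx
    exact ⟨_, h _ hx, fun n => (ETilde_spec hr ht hs hp (hR n)).2.2 x hx⟩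

/-! ### The three characterizations in terms of weighted sums -/

section Weighted

variable {p q : ℕ → ℝ} {B : ℕ → ℕ → 𝕜}

theorem weightedSum_rpow_eq {N : ℕ} (hN : 1 ≤ N) {u : ℕ → 𝕜}
    (hu : Summable fun k => ‖u k‖ * weight p N k) {a : ℝ} (ha : 0 ≤ a) :
    weightedSum p N u ^ a = ENNReal.ofReal ((∑' k, ‖u k * (weight p N k : 𝕜)‖) ^ a) := by
  have h0 : ∀ k, 0 ≤ ‖u k‖ * weight p N k := fun k =>
    mul_nonneg (norm_nonneg _) (weight_pos p hN k).le
  simp only [norm_mul_weight p hN]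
  rw [← ENNReal.ofReal_rpow_of_nonneg (tsum_nonneg h0) ha, ENNReal.ofReal_tsum_of_nonneg h0 hu]
  rfl

theorem weightedSum_eq {N : ℕ} (hN : 1 ≤ N) {u : ℕ → 𝕜}
    (hu : Summable fun k => ‖u k‖ * weight p N k) :
    weightedSum p N u = ENNReal.ofReal (∑' k, ‖u k * (weight p N k : 𝕜)‖) := by
  simpa using weightedSum_rpow_eq hN hu zero_le_one

theorem summable_of_weightedSum_ne_top {N : ℕ} (hN : 1 ≤ N) {u : ℕ → 𝕜}
    (hu : weightedSum p N u ≠ ⊤) : Summable fun k => ‖u k‖ * weight p N k := by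
  have h0 : ∀ k, 0 ≤ ‖u k‖ * weight p N k := fun k =>
    mul_nonneg (norm_nonneg _) (weight_pos p hN k).le
  refine (ENNReal.summable_toReal hu).congr fun k => ?_
  exact ENNReal.toReal_ofReal (h0 k)

theorem tendsto_ofReal_zero_iff {u : ℕ → ℝ} (hu : ∀ n, 0 ≤ u n) :
    Tendsto (fun n => ENNReal.ofReal (u n)) atTop (𝓝 0) ↔ Tendsto u atTop (𝓝 0) := by
  constructor
  · intro h
    have := (ENNReal.tendsto_toReal ENNReal.zero_ne_top).comp h
    simpa [Function.comp_def, ENNReal.toReal_ofReal (hu _)] using this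
  · intro h
    simpa using ENNReal.tendsto_ofReal h

theorem iSup_ofReal_lt_top_iff {u : ℕ → ℝ} :
    (⨆ n, ENNReal.ofReal (u n)) < ⊤ ↔ BddAbove (Set.range u) := by
  constructor
  · intro h
    refine ⟨(⨆ n, ENNReal.ofReal (u n)).toReal, ?_⟩
    rintro _ ⟨n, rfl⟩
    exact (ENNReal.ofReal_le_iff_le_toReal h.ne).1 (le_iSup (fun n => ENNReal.ofReal (u n)) n)
  · rintro ⟨M, hM⟩
    exact (iSup_le fun n => ENNReal.ofReal_le_ofReal (hM ⟨n, rfl⟩)).trans_lt ENNReal.ofReal_lt_top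

theorem tsum_norm_rpow_nonneg (f : ℕ → 𝕜) (a : ℝ) : 0 ≤ (∑' k, ‖f k‖) ^ a :=
  Real.rpow_nonneg (tsum_nonneg fun _ => norm_nonneg _) a

theorem norm_tsum_mul_rpow_le {f z : ℕ → 𝕜} (hf : Summable fun k => ‖f k‖) (hz : ∀ k, ‖z k‖ ≤ 1)
    {a : ℝ} (ha : 0 ≤ a) : ‖∑' k, f k * z k‖ ^ a ≤ (∑' k, ‖f k‖) ^ a :=
  Real.rpow_le_rpow (norm_nonneg _) (norm_tsum_mul_le hf hz) ha

theorem forall_mem_cZero_iff_condNull (hp : ∀ k, 0 < p k) (hq : ∀ k, 0 < q k)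
    (hq' : BddAbove (Set.range q))
    (hB : ∀ n, ∀ N : ℕ, 1 ≤ N → Summable fun k => ‖B n k‖ * weight p N k) :
    (∀ y ∈ lInfty p, (fun n => ∑' k, B n k * y k) ∈ cZero q) ↔ CondNull p q B := by
  have hB' : ∀ N : ℕ, 1 ≤ N → ∀ n, Summable fun k => ‖B n k * (weight p N k : 𝕜)‖ :=
    fun N hN n => by simpa only [norm_mul_weight p hN] using hB n N hN
  have hiff : ∀ N : ℕ, 1 ≤ N → (Tendsto (fun n => weightedSum p N (B n) ^ q n) atTop (𝓝 0) ↔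
      Tendsto (fun n => (∑' k, ‖B n k * (weight p N k : 𝕜)‖) ^ q n) atTop (𝓝 0)) := by
    intro N hN
    rw [← tendsto_ofReal_zero_iff fun n => tsum_norm_rpow_nonneg _ _]
    simp only [weightedSum_rpow_eq hN (hB _ N hN) (hq _).le]
  constructor
  · intro h N hN
    rw [hiff N hN]
    refine tendsto_tsum_norm_rpow (hB' N hN) hq hq' fun z hz => ?_
    simp only [mul_assoc]
    exact h _ (weight_mul_mem_lInfty hp hN hz)
  · intro h y hy
    obtain ⟨N, hN, z, hz, rfl⟩ := exists_weight_mul_eq hp hy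
    refine squeeze_zero (fun n => Real.rpow_nonneg (norm_nonneg _) _) (fun n => ?_)
      ((hiff N hN).1 (h N hN))
    simpa only [mul_assoc] using norm_tsum_mul_rpow_le (hB' N hN n) hz (hq n).le

theorem forall_mem_lInfty_iff_condSupPow (hp : ∀ k, 0 < p k) (hq : ∀ k, 0 < q k)
    (hq' : BddAbove (Set.range q))
    (hB : ∀ n, ∀ N : ℕ, 1 ≤ N → Summable fun k => ‖B n k‖ * weight p N k) :
    (∀ y ∈ lInfty p, (fun n => ∑' k, B n k * y k) ∈ lInfty q) ↔ CondSupPow p q B := by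
  have hB' : ∀ N : ℕ, 1 ≤ N → ∀ n, Summable fun k => ‖B n k * (weight p N k : 𝕜)‖ :=
    fun N hN n => by simpa only [norm_mul_weight p hN] using hB n N hN
  have hiff : ∀ N : ℕ, 1 ≤ N → ((⨆ n, weightedSum p N (B n) ^ q n) < ⊤ ↔
      BddAbove (Set.range fun n => (∑' k, ‖B n k * (weight p N k : 𝕜)‖) ^ q n)) := by
    intro N hN
    rw [← iSup_ofReal_lt_top_iff]
    simp only [weightedSum_rpow_eq hN (hB _ N hN) (hq _).le]
  constructor
  · intro h N hN
    rw [hiff N hN]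
    refine bddAbove_tsum_norm_rpow (hB' N hN) hq hq' fun z hz => ?_
    simp only [mul_assoc]
    exact h _ (weight_mul_mem_lInfty hp hN hz)
  · intro h y hy
    obtain ⟨N, hN, z, hz, rfl⟩ := exists_weight_mul_eq hp hy
    obtain ⟨M, hM⟩ := (hiff N hN).1 (h N hN)
    refine ⟨M, ?_⟩
    rintro _ ⟨n, rfl⟩
    refine le_trans ?_ (hM ⟨n, rfl⟩)
    simpa only [mul_assoc] using norm_tsum_mul_rpow_le (hB' N hN n) hz (hq n).le

theorem summable_norm_sub_mul_weight {N : ℕ} (hN : 1 ≤ N) {u v : ℕ → 𝕜}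
    (hu : Summable fun k => ‖u k‖ * weight p N k) (hv : Summable fun k => ‖v k‖ * weight p N k) :
    Summable fun k => ‖u k - v k‖ * weight p N k :=
  Summable.of_nonneg_of_le (fun k => mul_nonneg (norm_nonneg _) (weight_pos p hN k).le)
    (fun k => by
      rw [← add_mul]
      exact mul_le_mul_of_nonneg_right (norm_sub_le _ _) (weight_pos p hN k).le)
    (hu.add hv)

theorem forall_mem_cSpace_iff_condConv (hp : ∀ k, 0 < p k) (hq : ∀ k, 0 < q k)
    (hq' : BddAbove (Set.range q))
    (hB : ∀ n, ∀ N : ℕ, 1 ≤ N → Summable fun k => ‖B n k‖ * weight p N k) :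
    (∀ y ∈ lInfty p, (fun n => ∑' k, B n k * y k) ∈ cSpace q) ↔
      CondSup p B ∧ CondConv p q B := by
  have hB' : ∀ N : ℕ, 1 ≤ N → ∀ n, Summable fun k => ‖B n k * (weight p N k : 𝕜)‖ :=
    fun N hN n => by simpa only [norm_mul_weight p hN] using hB n N hN
  constructor
  · intro h
    have hschur := fun (N : ℕ) (hN : 1 ≤ N) =>
      exists_tendsto_tsum_norm_sub_rpow (hB' N hN) hq hq' fun z hz => by
        simp only [mul_assoc]
        exact h _ (weight_mul_mem_lInfty hp hN hz)
    obtain ⟨α, hα, -⟩ := hschur 1 le_rfl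
    simp only [weight_one, RCLike.ofReal_one, mul_one] at hα
    have hα' : ∀ N : ℕ, 1 ≤ N → (Summable fun k => ‖α k‖ * weight p N k) ∧
        Tendsto (fun n => ∑' k, ‖(B n k - α k) * (weight p N k : 𝕜)‖) atTop (𝓝 0) ∧
        Tendsto (fun n => (∑' k, ‖(B n k - α k) * (weight p N k : 𝕜)‖) ^ q n) atTop (𝓝 0) := by
      intro N hN
      obtain ⟨β, h1, h2, h3, h4⟩ := hschur N hN
      have : β = fun k => α k * (weight p N k : 𝕜) :=
        funext fun k => tendsto_nhds_unique (h1 k) ((hα k).mul_const _)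
      subst this
      simp only [← sub_mul] at h3 h4
      simp only [norm_mul_weight p hN (α _)] at h2
      exact ⟨h2, h3, h4⟩
    refine ⟨fun N hN => ?_, α, fun N hN => ?_⟩
    -- The convergent sequence of weighted ℓ¹ distances to α is bounded; adding the norm of α bounds
    -- the rows.
    · obtain ⟨hs, ht, -⟩ := hα' N hN
      simp only [weightedSum_eq hN (hB _ N hN)]
      rw [iSup_ofReal_lt_top_iff]
      obtain ⟨M, hM⟩ := ht.bddAbove_range
      refine ⟨M + ∑' k, ‖α k * (weight p N k : 𝕜)‖, ?_⟩
      rintro _ ⟨n, rfl⟩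
      have hs' : Summable fun k => ‖α k * (weight p N k : 𝕜)‖ := by
        simpa only [norm_mul_weight p hN] using hs
      have hd : Summable fun k => ‖(B n k - α k) * (weight p N k : 𝕜)‖ := by
        simpa only [norm_mul_weight p hN] using summable_norm_sub_mul_weight hN (hB n N hN) hs
      refine le_trans ?_ (add_le_add_left (hM ⟨n, rfl⟩) _)
      rw [← hd.tsum_add hs']
      refine (hB' N hN n).tsum_le_tsum (fun k => ?_) (hd.add hs')
      refine le_trans (le_of_eq ?_) (norm_add_le _ _)
      rw [← add_mul, sub_add_cancel]
    · obtain ⟨hs, -, ht⟩ := hα' N hN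
      rw [← tendsto_ofReal_zero_iff fun n => tsum_norm_rpow_nonneg _ _] at ht
      refine ht.congr fun n => ?_
      rw [weightedSum_rpow_eq hN (summable_norm_sub_mul_weight hN (hB n N hN) hs) (hq n).le]
  · rintro ⟨-, α, hα⟩
    have hsub : ∀ n, ∀ N : ℕ, 1 ≤ N → Summable fun k => ‖B n k - α k‖ * weight p N k := by
      intro n N hN
      -- One row m at finite weighted distance from α suffices: B_n - α = (B_n - B_m) - (α - B_m).
      -- Finiteness of the power transfers to the sum because q_m > 0.
      obtain ⟨m, hm⟩ := ((hα N hN).eventually_lt_const ENNReal.zero_lt_top).exists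
      have hm' : Summable fun k => ‖B m k - α k‖ * weight p N k := by
        refine summable_of_weightedSum_ne_top hN fun htop => ?_
        rw [htop, ENNReal.top_rpow_of_pos (hq m)] at hm
        exact lt_irrefl _ hm
      have := summable_norm_sub_mul_weight hN (summable_norm_sub_mul_weight hN (hB n N hN)
        (hB m N hN)) (v := fun k => α k - B m k) (by simpa only [norm_sub_rev] using hm')
      simpa using this
    have hnull := (forall_mem_cZero_iff_condNull (B := fun n k => B n k - α k) hp hq hq' hsub).2 hα
    intro y hy
    refine ⟨∑' k, α k * y k, ?_⟩
    have hy' := hnull y hy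
    obtain ⟨N, hN, z, hz, rfl⟩ := exists_weight_mul_eq hp hy
    refine Tendsto.congr (fun n => ?_) hy'
    have hsum : ∀ u : ℕ → 𝕜, (Summable fun k => ‖u k‖ * weight p N k) →
        Summable fun k => u k * ((weight p N k : 𝕜) * z k) := by
      intro u hu
      simp only [← mul_assoc]
      exact summable_mul_of_norm_le_one (by simpa only [norm_mul_weight p hN] using hu) hz
    have hαs : Summable fun k => ‖α k‖ * weight p N k := by
      simpa using summable_norm_sub_mul_weight hN (hB n N hN) (hsub n N hN)
    rw [← (hsum _ (hB n N hN)).tsum_sub (hsum _ hαs)]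
    simp only [← sub_mul]

end Weighted

end SeqSpace

/-- The first part says that the entries `ẽ_{nk}` are well defined (the limits exist) as soon as
the rows of `A` lie in the β-dual; the other three parts are the characterizations. -/
theorem corollary4p3 {𝕜 : Type*} [RCLike 𝕜] (r s t : ℕ → 𝕜) (p q : ℕ → ℝ)
    (hr : ∀ n, r n ≠ 0) (ht : ∀ n, t n ≠ 0) (hs : s 0 ≠ 0)
    (hp : ∀ k, 0 < p k) (hp' : BddAbove (Set.range p))
    (hq : ∀ k, 0 < q k) (hq' : BddAbove (Set.range q))
    (A : ℕ → ℕ → 𝕜) :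
    ((∀ n, A n ∈ SeqSpace.betaDual (SeqSpace.lInftyMeanDiff r s t p)) →
      ∀ n k, Filter.Tendsto (fun m => SeqSpace.E r s t (A n) m k) Filter.atTop
        (nhds (SeqSpace.ETilde r s t A n k))) ∧
    (A ∈ SeqSpace.matrixClass (SeqSpace.lInftyMeanDiff r s t p) (SeqSpace.cZero q) ↔
      (∀ n, A n ∈ SeqSpace.betaDual (SeqSpace.lInftyMeanDiff r s t p)) ∧
        SeqSpace.CondNull p q (SeqSpace.ETilde r s t A)) ∧
    (A ∈ SeqSpace.matrixClass (SeqSpace.lInftyMeanDiff r s t p) (SeqSpace.cSpace q) ↔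
      (∀ n, A n ∈ SeqSpace.betaDual (SeqSpace.lInftyMeanDiff r s t p)) ∧
        SeqSpace.CondSup p (SeqSpace.ETilde r s t A) ∧
        SeqSpace.CondConv p q (SeqSpace.ETilde r s t A)) ∧
    (A ∈ SeqSpace.matrixClass (SeqSpace.lInftyMeanDiff r s t p) (SeqSpace.lInfty q) ↔
      (∀ n, A n ∈ SeqSpace.betaDual (SeqSpace.lInftyMeanDiff r s t p)) ∧
        SeqSpace.CondSupPow p q (SeqSpace.ETilde r s t A)) := by
  have hspec := fun (hR : ∀ n, A n ∈ SeqSpace.betaDual (SeqSpace.lInftyMeanDiff r s t p)) n =>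
    SeqSpace.ETilde_spec hr ht hs hp (hR n)
  refine ⟨fun hR n => (hspec hR n).1, ?_, ?_, ?_⟩
  · rw [SeqSpace.mem_matrixClass_iff hr ht hs hp]
    exact and_congr_right fun hR => SeqSpace.forall_mem_cZero_iff_condNull hp hq hq'
      fun n => (hspec hR n).2.1
  · rw [SeqSpace.mem_matrixClass_iff hr ht hs hp]
    exact and_congr_right fun hR => SeqSpace.forall_mem_cSpace_iff_condConv hp hq hq'
      fun n => (hspec hR n).2.1
  · rw [SeqSpace.mem_matrixClass_iff hr ht hs hp]
    exact and_congr_right fun hR => SeqSpace.forall_mem_lInfty_iff_condSupPow hp hq hq'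
      fun n => (hspec hR n).2.1
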